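/- Let $H$ be a separable real Hilbert space. For $p\in\{1,2\}$ let $B_p(H)$ be the Schatten class of compact operators $K$ with $\|K\|_p=\big(\sum_l\langle e_l,(K^*K)^{p/2}e_l\rangle\big)^{1/p}<\infty$, where $(e_l)$ is an orthonormal basis of $H$, so that $B_1(H)$ are the trace-class and $B_2(H)$ the Hilbert–Schmidt operators. Let $\operatorname{tr}K=\sum_l\langle e_l,Ke_l\rangle$ be the trace of $K\in B_1(H)$, and let $B_1^+(H)$ be the set of self-adjoint non-negative definite trace-class operators. For a compact self-adjoint operator $K$ and a bounded function $f$ on its set of eigenvalues, put $f(K)=\sum_\lambda f(\lambda)\Pi_\lambda$, where the sum runs over the distinct eigenvalues $\lambda$ of $K$ (including $0$ if $K$ is not injective), $\Pi_\lambda$ is the orthogonal projection onto $\ker(K-\lambda I)$, and the series converges in the strong operator topology. Let $\varepsilon>0$, let $A,B\in B_1^+(H)$, and let $G,M\in B_2(H)$ satisfy $GG^*=A$ and $MM^*=B$. Suppose that $G$ and $M$ are properly aligned, i.e. $G^*M\in B_1^+(H)$. Let $$\mathcal F(G,M)=\{R\in B_2(H):\ \ker R\supseteq\ker M,\ \operatorname{ran}R\subseteq(\ker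 G)^\perp,\ \|R\|_\infty<1\},$$ where $\|\cdot\|_\infty$ is the operator norm, and for $R\in\mathcal F(G,M)$ let $$\mathcal P_\varepsilon(R)=2\operatorname{tr}[R\,M^*G]+\varepsilon\log\det(I-R^*R),$$ where $\det$ is the Fredholm determinant. Define $$f_\varepsilon(x)=\frac{2x}{\sqrt{4x^2+\varepsilon^2}+\varepsilon}\qquad(x\ge 0).$$ Then $f_\varepsilon$ maps $[0,\infty)$ into $[0,1)$, and $R_\varepsilon:=f_\varepsilon(G^*M)$ belongs to $\mathcal F(G,M)$ and is the unique maximiser of $\mathcal P_\varepsilon$ over $\mathcal F(G,M)$. Moreover $R_\varepsilon\in B_1^+(H)$, and $$\|R_\varepsilon\|_1\le\frac{2}{\varepsilon}\operatorname{tr}(G^*M).$$ -/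

import Mathlib

open scoped InnerProductSpace
open Filter Topology ContinuousLinearMap

noncomputable section

namespace GaussianEOT

variable {H : Type*} [NormedAddCommGroup H] [InnerProductSpace ℝ H] [CompleteSpace H]

/-! ### Functional calculus of compact self-adjoint operators on a real Hilbert space -/

/-- The orthogonal projection `Π_μ` onto the eigenspace `ker (A - μ I)`. It is `0` whenever `μ` is
not an eigenvalue of `A`. -/
def eigenProj (A : H →L[ℝ] H) (μ : ℝ) : H →L[ℝ] H :=
  (A - μ • ContinuousLinearMap.id ℝ H).ker.starProjection

open Classical in
/-- The operator `f(A) = ∑_μ f(μ) Π_μ`, the sum being taken over all eigenvalues `μ` of `A`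
(including `μ = 0` if `A` is not injective) and converging unconditionally in the strong operator
topology. It is set to `0` if there is no bounded operator which is the sum of that series; by
`hasSum_spectralCalculus` the series does converge if `A` is self-adjoint and `f` is bounded on
the eigenvalues of `A`. -/
def spectralCalculus (f : ℝ → ℝ) (A : H →L[ℝ] H) : H →L[ℝ] H :=
  if h : ∃ R : H →L[ℝ] H, ∀ v, HasSum (fun μ : ℝ => f μ • eigenProj A μ v) (R v)
  then h.choose else 0

theorem eigenProj_orthogonalFamily {A : H →L[ℝ] H} (hA : IsSelfAdjoint A) :
    OrthogonalFamily ℝ (fun μ : ℝ => (A - μ • ContinuousLinearMap.id ℝ H).ker)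
      fun μ => (A - μ • ContinuousLinearMap.id ℝ H).ker.subtypeₗᵢ := by
  rintro μ ν hμν ⟨v, hv⟩ ⟨w, hw⟩
  simp only [LinearMap.mem_ker, ContinuousLinearMap.coe_coe, _root_.sub_apply,
    _root_.smul_apply, ContinuousLinearMap.id_apply, sub_eq_zero] at hv hw
  have h : ⟪A v, w⟫_ℝ = ⟪v, A w⟫_ℝ := hA.isSymmetric v w
  rw [hv, hw, real_inner_smul_left, real_inner_smul_right] at h
  have h0 : (μ - ν) * ⟪v, w⟫_ℝ = 0 := by linarith
  exact (mul_eq_zero.1 h0).resolve_left (sub_ne_zero.2 hμν)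

theorem sum_norm_sq_eigenProj_le {A : H →L[ℝ] H} (hA : IsSelfAdjoint A) (v : H) (s : Finset ℝ) :
    ∑ μ ∈ s, ‖eigenProj A μ v‖ ^ 2 ≤ ‖v‖ ^ 2 := by
  have h1 := (eigenProj_orthogonalFamily hA).norm_sum
    (fun μ => (A - μ • ContinuousLinearMap.id ℝ H).ker.orthogonalProjectionOnto v) s
  have h1' : ‖∑ μ ∈ s, eigenProj A μ v‖ ^ 2 = ∑ μ ∈ s, ‖eigenProj A μ v‖ ^ 2 := h1
  have h2 : ⟪∑ μ ∈ s, eigenProj A μ v, v⟫_ℝ = ∑ μ ∈ s, ‖eigenProj A μ v‖ ^ 2 := by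
    rw [sum_inner]
    refine Finset.sum_congr rfl fun μ _ => ?_
    have h3 := Submodule.inner_starProjection_left_eq_right
      (A - μ • ContinuousLinearMap.id ℝ H).ker (eigenProj A μ v) v
    rw [← real_inner_self_eq_norm_sq]
    have h4 : eigenProj A μ (eigenProj A μ v) = eigenProj A μ v :=
      Submodule.starProjection_eq_self_iff.2 (Submodule.starProjection_apply_mem _ v)
    calc ⟪eigenProj A μ v, v⟫_ℝ = ⟪eigenProj A μ (eigenProj A μ v), v⟫_ℝ := by rw [h4]
      _ = ⟪eigenProj A μ v, eigenProj A μ v⟫_ℝ := h3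
  have h5 := real_inner_le_norm (∑ μ ∈ s, eigenProj A μ v) v
  rw [h2, ← h1'] at h5
  rw [← h1']
  nlinarith [norm_nonneg (∑ μ ∈ s, eigenProj A μ v), norm_nonneg v]

/-- The series defining `f(A)` converges in the strong operator topology. -/
theorem hasSum_spectralCalculus {A : H →L[ℝ] H} (hA : IsSelfAdjoint A) (f : ℝ → ℝ) (C : ℝ)
    (hf : ∀ μ : ℝ, (A - μ • ContinuousLinearMap.id ℝ H).ker ≠ ⊥ → |f μ| ≤ C) (v : H) :
    HasSum (fun μ : ℝ => f μ • eigenProj A μ v) (spectralCalculus f A v) := by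
  have hterm : ∀ (v : H) (μ : ℝ),
      ‖f μ • (A - μ • ContinuousLinearMap.id ℝ H).ker.orthogonalProjectionOnto v‖ ^ 2
        ≤ |C| ^ 2 * ‖eigenProj A μ v‖ ^ 2 := by
    intro v μ
    have e : ‖f μ • (A - μ • ContinuousLinearMap.id ℝ H).ker.orthogonalProjectionOnto v‖ ^ 2
        = |f μ| ^ 2 * ‖eigenProj A μ v‖ ^ 2 := by
      rw [norm_smul, mul_pow, Real.norm_eq_abs]; rfl
    rw [e]
    by_cases hμ : (A - μ • ContinuousLinearMap.id ℝ H).ker = ⊥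
    · have : eigenProj A μ v = 0 := by
        have hm : eigenProj A μ v ∈ (A - μ • ContinuousLinearMap.id ℝ H).ker :=
          Submodule.starProjection_apply_mem _ v
        rwa [hμ, Submodule.mem_bot] at hm
      simp [this]
    · exact mul_le_mul_of_nonneg_right
        (pow_le_pow_left₀ (abs_nonneg _) ((hf μ hμ).trans (le_abs_self C)) 2) (by positivity)
  have hs : ∀ v, Summable (fun μ : ℝ => f μ • eigenProj A μ v) := fun v =>
    ((eigenProj_orthogonalFamily hA).summable_iff_norm_sq_summable
      (fun μ => f μ • (A - μ • ContinuousLinearMap.id ℝ H).ker.orthogonalProjectionOnto v)).2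
      (Summable.of_nonneg_of_le (fun _ => by positivity) (hterm v)
        ((summable_of_sum_le (fun _ => by positivity)
          (sum_norm_sq_eigenProj_le hA v)).mul_left (|C| ^ 2)))
  have hbound : ∀ (v : H) (s : Finset ℝ), ‖∑ μ ∈ s, f μ • eigenProj A μ v‖ ≤ |C| * ‖v‖ := by
    intro v s
    have h1 : ‖∑ μ ∈ s, f μ • eigenProj A μ v‖ ^ 2 = _ :=
      (eigenProj_orthogonalFamily hA).norm_sum
        (fun μ => f μ • (A - μ • ContinuousLinearMap.id ℝ H).ker.orthogonalProjectionOnto v) s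
    refine abs_le_of_sq_le_sq' ?_ (by positivity) |>.2
    rw [h1, mul_pow]
    refine (Finset.sum_le_sum fun μ _ => hterm v μ).trans ?_
    rw [← Finset.mul_sum]
    gcongr
    exact sum_norm_sq_eigenProj_le hA v s
  have hex : ∃ R : H →L[ℝ] H, ∀ v, HasSum (fun μ : ℝ => f μ • eigenProj A μ v) (R v) :=
    ⟨LinearMap.mkContinuous
      { toFun := fun v => ∑' μ : ℝ, f μ • eigenProj A μ v
        map_add' := fun v w => by
          rw [← (hs v).tsum_add (hs w)]
          simp only [map_add, smul_add]
        map_smul' := fun c v => by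
          rw [RingHom.id_apply, ← (hs v).tsum_const_smul c]
          simp only [map_smul, smul_comm c] }
      |C| fun v => le_of_tendsto (hs v).hasSum.norm (Eventually.of_forall (hbound v)),
      fun v => (hs v).hasSum⟩
  unfold spectralCalculus
  rw [dif_pos hex]
  exact hex.choose_spec v

/-! ### Trace, Schatten classes, Fredholm determinant -/

variable (H) in
/-- The index set of a fixed orthonormal basis of `H`. -/
def onbSet : Set H := (exists_hilbertBasis ℝ H).choose

variable (H) in
/-- A fixed orthonormal basis of `H`. -/
def onb : HilbertBasis (onbSet H) ℝ H := (exists_hilbertBasis ℝ H).choose_spec.choose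

/-- The trace `∑_l ⟪e_l, K e_l⟫`. -/
def trace (K : H →L[ℝ] H) : ℝ := ∑' l, ⟪onb H l, K (onb H l)⟫_ℝ

/-- `(K* K)^{p/2} = |K|^p`. -/
def absPow (p : ℝ) (K : H →L[ℝ] H) : H →L[ℝ] H :=
  spectralCalculus (fun x => x ^ (p / 2)) (adjoint K ∘L K)

/-- `K` belongs to the Schatten class `B_p(H)`: it is compact and
`∑_l ⟪e_l, (K* K)^{p/2} e_l⟫ < ∞`. -/
def IsSchatten (p : ℝ) (K : H →L[ℝ] H) : Prop :=
  IsCompactOperator K ∧ Summable fun l => ⟪onb H l, absPow p K (onb H l)⟫_ℝ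

/-- The Schatten norm `(∑_l ⟪e_l, (K* K)^{p/2} e_l⟫)^{1/p}` of `K ∈ B_p(H)`. -/
def schattenNorm (p : ℝ) (K : H →L[ℝ] H) : ℝ := trace (absPow p K) ^ (1 / p)

/-- `K ∈ B_1^+(H)`: `K` is a non-negative definite (self-adjoint) trace-class operator. -/
def IsPosTraceClass (K : H →L[ℝ] H) : Prop := IsSchatten 1 K ∧ K.IsPositive

/-- The compression `P_V T |_V : V → V` of `T` to a finite-dimensional subspace `V`, here the
linear span of a finite set `s`. -/
def compression (T : H →L[ℝ] H) (s : Finset H) :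
    Submodule.span ℝ (s : Set H) →ₗ[ℝ] Submodule.span ℝ (s : Set H) :=
  ((Submodule.span ℝ (s : Set H)).orthogonalProjectionOnto ∘L T ∘L
    (Submodule.span ℝ (s : Set H)).subtypeL : _ →L[ℝ] _)

/-- The Fredholm determinant `det (I + T)` of a trace-class perturbation of the identity: the limit
of the determinants `det (I + P_V T P_V) = det (I_V + P_V T |_V)` along the finite-dimensional
subspaces `V` of `H`, directed by inclusion (the finite-rank operators `P_V T P_V` converge to `T`
in trace norm, and the Fredholm determinant is the trace-norm continuous extension of the
determinant of finite-rank perturbations of the identity). -/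
def fredholmDet (T : H →L[ℝ] H) : ℝ :=
  limUnder (atTop : Filter (Finset H)) fun s => LinearMap.det (LinearMap.id + compression T s)

/-! ### Green's operators and the entropic profit -/

/-- `G ∈ 𝒢(A)`: `G` is a Hilbert–Schmidt operator with `G G* = A`. -/
def IsGreen (A G : H →L[ℝ] H) : Prop := IsSchatten 2 G ∧ G ∘L adjoint G = A

/-- `G` and `M` are properly aligned: `G* M` is a non-negative definite trace-class operator. -/
def ProperlyAligned (G M : H →L[ℝ] H) : Prop := IsPosTraceClass (adjoint G ∘L M)

/-- The set `ℱ(G, M)` of admissible correlations: Hilbert–Schmidt operators `R` with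
`ker R ⊇ ker M`, `range R ⊆ (ker G)ᗮ` and operator norm `< 1`. -/
def admissible (G M : H →L[ℝ] H) : Set (H →L[ℝ] H) :=
  {R | IsSchatten 2 R ∧ M.ker ≤ R.ker ∧ R.range ≤ G.kerᗮ ∧ ‖R‖ < 1}

/-- The entropic profit `𝒫_ε(R) = 2 tr[R M* G] + ε log det(I - R* R)`. -/
def profit (ε : ℝ) (G M R : H →L[ℝ] H) : ℝ :=
  2 * trace (R ∘L (adjoint M ∘L G)) + ε * Real.log (fredholmDet (-(adjoint R ∘L R)))

/-- The spectral shrinkage function `f_ε(x) = 2x / (√(4x² + ε²) + ε)`. -/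
def shrinkage (ε x : ℝ) : ℝ := 2 * x / (√(4 * x ^ 2 + ε ^ 2) + ε)

end GaussianEOT

end

noncomputable section

namespace GaussianEOT

set_option linter.unusedSectionVars false

variable {H : Type*} [NormedAddCommGroup H] [InnerProductSpace ℝ H] [CompleteSpace H]

/-! ### Determinants of compressions of contractions -/

/-! Put K = G*M. Since K is positive and trace class, M*G = K as well, and K has an orthonormal
eigenbasis b with summable eigenvalues μ i ≥ 0. Computed in that basis, the linear part of the
profit is 2 ∑ μ i ⟪b i, R b i⟫.

The determinant is handled by Hadamard's inequality, log det(I - R*R) ≤ ∑ log(1 - ‖R b i‖²)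
(`fredholmDet_le_prod`, `log_fredholmDet_le_tsum`). If R is diagonal in b, Jensen's inequality for
the concave logarithm gives the reverse bound (`tsum_log_le_log_fredholmDet`). The profit is thus at
most a sum of decoupled scalar profits, with equality for R diagonal in b.

With f the shrinkage of μ i, stationarity reads μ i (1 - f²) = ε f. The tangent of log at 1 - f²
then shows that the i-th scalar profit of R falls short of that of S = f_ε(K) by at least ε ‖R b i -
S b i‖² (`scalar_profit_le`, `profit_add_sum_le`). This gap yields optimality and uniqueness
together. The kernel and range constraints matter only for the admissibility of S, which factors
through K = G*M = M*G. The trace bound is f_ε(x) ≤ 2x/ε summed over the eigenvalues. -/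

/-- The determinant of `I + P_V T P_V`, where `V` is the span of `s`. -/
def compressedDet (T : H →L[ℝ] H) (s : Finset H) : ℝ :=
  LinearMap.det (LinearMap.id + compression T s)

/-- A determinant does not depend on the basis. The free choice of v allows a vector to be adjoined
to a given basis, or the compression to be diagonalised. -/
theorem compressedDet_eq_det {ι : Type*} [Fintype ι] [DecidableEq ι] (T : H →L[ℝ] H)
    (s : Finset H) (v : ι → H) (hv : Orthonormal ℝ v)
    (hs : Submodule.span ℝ (Set.range v) = Submodule.span ℝ (s : Set H)) :
    compressedDet T s =
      (Matrix.of fun i j => (if i = j then 1 else 0) + ⟪v i, T (v j)⟫_ℝ).det := by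
  set V := Submodule.span ℝ (s : Set H) with hV
  have hmem : ∀ i, v i ∈ V := fun i => hs ▸ Submodule.subset_span ⟨i, rfl⟩
  let w : ι → V := fun i => ⟨v i, hmem i⟩
  have hw : Orthonormal ℝ w := by
    refine ⟨fun i => hv.1 i, fun i j hij => hv.2 hij⟩
  have hsp : ⊤ ≤ Submodule.span ℝ (Set.range w) := by
    intro x _
    have hx : (x : H) ∈ Submodule.span ℝ (Set.range v) := by rw [hs]; exact x.2
    have hr : Set.range v = V.subtype '' Set.range w := by
      rw [← Set.range_comp]; rfl
    rw [hr, Submodule.span_image] at hx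
    obtain ⟨y, hy, hyx⟩ := hx
    have : y = x := Subtype.ext hyx
    exact this ▸ hy
  let b := OrthonormalBasis.mk hw hsp
  have hb : ∀ i, b i = w i := fun i => by simp [b]
  unfold compressedDet
  rw [← LinearMap.det_toMatrix b.toBasis]
  congr 1
  ext i j
  rw [LinearMap.toMatrix_apply, OrthonormalBasis.coe_toBasis_repr_apply,
    OrthonormalBasis.repr_apply_apply, OrthonormalBasis.coe_toBasis, hb, hb, LinearMap.add_apply,
    inner_add_right, Matrix.of_apply, LinearMap.id_apply, orthonormal_iff_ite.1 hw]
  congr 1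
  change ⟪w i, V.orthogonalProjectionOnto (T (w j))⟫_ℝ = _
  rw [Submodule.inner_orthogonalProjectionOnto_eq_of_mem_left]

theorem span_range_coe_orthonormalBasis {ι : Type*} [Fintype ι] {V : Submodule ℝ H}
    (b : OrthonormalBasis ι ℝ V) :
    Submodule.span ℝ (Set.range fun i => (b i : H)) = V := by
  have hr : (Set.range fun i => (b i : H)) = V.subtype '' Set.range b := by
    rw [← Set.range_comp]; rfl
  rw [hr, Submodule.span_image, ← OrthonormalBasis.coe_toBasis, b.toBasis.span_eq,
    Submodule.map_top, Submodule.range_subtype]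

theorem inner_neg_adjoint_comp_self (R : H →L[ℝ] H) (x y : H) :
    ⟪x, (-(adjoint R ∘L R)) y⟫_ℝ = -⟪R x, R y⟫_ℝ := by
  simp [adjoint_inner_right]

/-- The matrix of a compression of `I - R* R` is positive definite. -/
theorem posDef_one_sub_gram {ι : Type*} [Fintype ι] [DecidableEq ι] {R : H →L[ℝ] H} (hR : ‖R‖ < 1)
    {v : ι → H} (hv : Orthonormal ℝ v) :
    (Matrix.of fun i j =>
      (if i = j then 1 else 0) + ⟪v i, (-(adjoint R ∘L R)) (v j)⟫_ℝ : Matrix ι ι ℝ).PosDef := by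
  refine Matrix.PosDef.of_dotProduct_mulVec_pos ?_ ?_
  · ext i j
    simp only [Matrix.conjTranspose_apply, Matrix.of_apply, inner_neg_adjoint_comp_self,
      star_trivial, eq_comm (a := j), real_inner_comm]
  · intro x hx
    set u : H := ∑ i, x i • v i with hu
    have h1 : star x ⬝ᵥ (Matrix.of fun i j =>
      (if i = j then 1 else 0) + ⟪v i, (-(adjoint R ∘L R)) (v j)⟫_ℝ : Matrix ι ι ℝ).mulVec x
        = ‖u‖ ^ 2 - ‖R u‖ ^ 2 := by
      have e : ‖u‖ ^ 2 = ∑ i, x i * x i := by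
        rw [← real_inner_self_eq_norm_sq, hu, hv.inner_sum]; simp
      rw [e, ← real_inner_self_eq_norm_sq, hu]
      simp only [map_sum, map_smul, sum_inner, inner_sum, dotProduct, Matrix.mulVec,
        Matrix.of_apply, inner_neg_adjoint_comp_self, real_inner_smul_left, real_inner_smul_right,
        Finset.mul_sum, star_trivial, ← Finset.sum_sub_distrib]
      refine Finset.sum_congr rfl fun i _ => ?_
      rw [show x i * x i = ∑ j, if i = j then x i * x j else 0 by simp, ← Finset.sum_sub_distrib]
      refine Finset.sum_congr rfl fun j _ => ?_
      rw [real_inner_comm (R (v i))]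
      split_ifs <;> ring
    rw [h1]
    have hu0 : u ≠ 0 := by
      intro h0
      apply hx
      exact funext fun i => Fintype.linearIndependent_iff.1 hv.linearIndependent x h0 i
    have h2 : ‖R u‖ < ‖u‖ := (R.le_opNorm u).trans_lt
      ((mul_lt_mul_of_pos_right hR (norm_pos_iff.2 hu0)).trans_eq (one_mul _))
    have := pow_lt_pow_left₀ h2 (norm_nonneg _) two_ne_zero
    linarith

/-- The determinant is det A times the Schur complement d - Bᵀ A⁻¹ B, and A⁻¹ is positive
semidefinite. -/
theorem _root_.Matrix.PosDef.det_fromBlocks_unit_le {ι : Type*} [Fintype ι] [DecidableEq ι]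
    {A : Matrix ι ι ℝ} (hA : A.PosDef) (B : Matrix ι Unit ℝ) (d : ℝ) :
    (Matrix.fromBlocks A B B.transpose (Matrix.of fun _ _ => d)).det ≤ A.det * d := by
  have : Invertible A := hA.isUnit.invertible
  rw [Matrix.det_fromBlocks₁₁, Matrix.det_unique (n := Unit)]
  refine mul_le_mul_of_nonneg_left ?_ hA.det_pos.le
  have h := hA.inv.posSemidef.dotProduct_mulVec_nonneg (fun i => B i ())
  have e : (B.transpose * ⅟A * B) () () = star (fun i => B i ()) ⬝ᵥ
      A⁻¹.mulVec (fun i => B i ()) := by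
    rw [Matrix.mul_assoc, Matrix.invOf_eq_nonsing_inv]
    rfl
  change d - (B.transpose * ⅟A * B) () () ≤ d
  rw [e]
  linarith

/-- Adjoining a unit vector orthogonal to the span borders the matrix by one row and column, so the
Schur complement bound applies. This single step drives both monotonicity and Hadamard's inequality.
-/
theorem compressedDet_le_mul {R : H →L[ℝ] H} (hR : ‖R‖ < 1) {s t : Finset H} {x : H}
    (hx : ‖x‖ = 1) (hxs : x ∈ (Submodule.span ℝ (s : Set H))ᗮ)
    (ht : Submodule.span ℝ (t : Set H) = Submodule.span ℝ (s : Set H) ⊔ Submodule.span ℝ {x}) :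
    compressedDet (-(adjoint R ∘L R)) t ≤
      compressedDet (-(adjoint R ∘L R)) s * (1 - ‖R x‖ ^ 2) := by
  classical
  set V := Submodule.span ℝ (s : Set H) with hV
  let b := stdOrthonormalBasis ℝ V
  let v : Fin (Module.finrank ℝ V) → H := fun i => (b i : H)
  have hv : Orthonormal ℝ v := b.orthonormal.comp_linearIsometry V.subtypeₗᵢ
  have hvs : Submodule.span ℝ (Set.range v) = V := span_range_coe_orthonormalBasis b
  have hxv : ∀ i, ⟪v i, x⟫_ℝ = 0 := fun i => hxs _ (b i).2
  let w : Fin (Module.finrank ℝ V) ⊕ Unit → H := Sum.elim v fun _ => x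
  have hw : Orthonormal ℝ w := by
    constructor
    · rintro (i | i)
      · exact hv.1 i
      · exact hx
    · rintro (i | i) (j | j) hij
      · exact hv.2 fun h => hij (by rw [h])
      · exact hxv i
      · exact (real_inner_comm _ _).trans (hxv j)
      · exact absurd rfl hij
  have hws : Submodule.span ℝ (Set.range w) = Submodule.span ℝ (t : Set H) := by
    rw [ht, Set.Sum.elim_range, Submodule.span_union, hvs, Set.range_const]
  rw [compressedDet_eq_det _ s v hv hvs, compressedDet_eq_det _ t w hw hws]
  convert (posDef_one_sub_gram hR hv).det_fromBlocks_unit_le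
    (Matrix.of fun i _ => ⟪v i, (-(adjoint R ∘L R)) x⟫_ℝ) (1 - ‖R x‖ ^ 2) using 2
  ext (i | i) (j | j)
  · simp [w]
  · simp [w]
  · simp [w, adjoint_inner_right, real_inner_comm]
  · simp [w, adjoint_inner_right, sub_eq_add_neg]

theorem compressedDet_congr (T : H →L[ℝ] H) {s t : Finset H}
    (h : Submodule.span ℝ (s : Set H) = Submodule.span ℝ (t : Set H)) :
    compressedDet T s = compressedDet T t := by
  let b := stdOrthonormalBasis ℝ (Submodule.span ℝ (s : Set H))
  have hv : Orthonormal ℝ fun i => (b i : H) :=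
    b.orthonormal.comp_linearIsometry (Submodule.span ℝ (s : Set H)).subtypeₗᵢ
  have hvs := span_range_coe_orthonormalBasis b
  rw [compressedDet_eq_det _ s _ hv hvs, compressedDet_eq_det _ t _ hv (hvs.trans h)]

/-- The compression of `I - R* R` to a finite-dimensional subspace is diagonal in some orthonormal
basis. -/
theorem exists_orthonormal_compressedDet_eq_prod (R : H →L[ℝ] H) (s : Finset H) :
    ∃ (n : ℕ) (v : Fin n → H), Orthonormal ℝ v ∧
      compressedDet (-(adjoint R ∘L R)) s = ∏ i, (1 - ‖R (v i)‖ ^ 2) := by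
  set V := Submodule.span ℝ (s : Set H) with hV
  have hsym : (compression (adjoint R ∘L R) s).IsSymmetric := by
    intro x y
    change ⟪V.orthogonalProjectionOnto ((adjoint R ∘L R) x), y⟫_ℝ =
      ⟪x, V.orthogonalProjectionOnto ((adjoint R ∘L R) y)⟫_ℝ
    rw [Submodule.inner_orthogonalProjectionOnto_eq_of_mem_left,
      Submodule.inner_orthogonalProjectionOnto_eq_of_mem_right]
    simp [adjoint_inner_right, adjoint_inner_left]
  let b := hsym.eigenvectorBasis rfl
  let v : Fin (Module.finrank ℝ V) → H := fun i => (b i : H)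
  have hv : Orthonormal ℝ v := b.orthonormal.comp_linearIsometry V.subtypeₗᵢ
  have hvs : Submodule.span ℝ (Set.range v) = V := span_range_coe_orthonormalBasis b
  refine ⟨_, v, hv, ?_⟩
  rw [compressedDet_eq_det _ s v hv hvs, ← Matrix.det_diagonal]
  congr 1
  ext i j
  rw [Matrix.of_apply, Matrix.diagonal_apply, inner_neg_adjoint_comp_self]
  split_ifs with hij
  · rw [hij, real_inner_self_eq_norm_sq]; ring
  · have h1 : ⟪R (v i), R (v j)⟫_ℝ = ⟪b i, compression (adjoint R ∘L R) s (b j)⟫_ℝ := by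
      change _ = ⟪b i, V.orthogonalProjectionOnto ((adjoint R ∘L R) (b j))⟫_ℝ
      rw [Submodule.inner_orthogonalProjectionOnto_eq_of_mem_left]
      simp [v, adjoint_inner_right]
    rw [h1, hsym.apply_eigenvectorBasis rfl j, inner_smul_right,
      show ⟪b i, hsym.eigenvectorBasis rfl j⟫_ℝ = 0 from b.orthonormal.2 hij]
    simp

/-! ### Monotone limit of the compressed determinants and Hadamard's inequality. -/

theorem norm_sq_apply_le {R : H →L[ℝ] H} {x : H} (hx : ‖x‖ = 1) : ‖R x‖ ^ 2 ≤ ‖R‖ ^ 2 := by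
  have h := R.le_opNorm x
  rw [hx, mul_one] at h
  exact pow_le_pow_left₀ (norm_nonneg _) h 2

theorem norm_sq_lt_one {R : H →L[ℝ] H} (hR : ‖R‖ < 1) : ‖R‖ ^ 2 < 1 :=
  pow_lt_one₀ (norm_nonneg _) hR two_ne_zero

theorem compressedDet_pos {R : H →L[ℝ] H} (hR : ‖R‖ < 1) (s : Finset H) :
    0 < compressedDet (-(adjoint R ∘L R)) s := by
  obtain ⟨n, v, hv, h⟩ := exists_orthonormal_compressedDet_eq_prod R s
  rw [h]
  exact Finset.prod_pos fun i _ =>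
    sub_pos.2 ((norm_sq_apply_le (hv.1 i)).trans_lt (norm_sq_lt_one hR))

/-- Inserting a vector either leaves the span unchanged or adds one orthogonal direction x, which
costs a factor at most 1 - ‖R x‖² ≤ 1. -/
theorem compressedDet_antitone {R : H →L[ℝ] H} (hR : ‖R‖ < 1) :
    Antitone (compressedDet (-(adjoint R ∘L R))) := by
  classical
  rw [Finset.antitone_iff_forall_insert_le]
  intro s a _
  set V := Submodule.span ℝ (s : Set H) with hV
  have hspan : Submodule.span ℝ ((insert a s : Finset H) : Set H) =
      V ⊔ Submodule.span ℝ {a} := by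
    rw [Finset.coe_insert, Submodule.span_insert, sup_comm]
  set p : H := V.starProjection a with hp
  have hpV : p ∈ V := Submodule.starProjection_apply_mem _ _
  by_cases ha : a - p = 0
  · refine (compressedDet_congr _ ?_).le
    rw [hspan, sup_eq_left, Submodule.span_singleton_le_iff_mem, sub_eq_zero.1 ha]
    exact hpV
  · have hn : ‖a - p‖ ≠ 0 := norm_ne_zero_iff.2 ha
    have ho : a - p ∈ Vᗮ := Submodule.sub_starProjection_mem_orthogonal a
    have hx1 : ‖‖a - p‖⁻¹ • (a - p)‖ = 1 := by
      rw [norm_smul, norm_inv, norm_norm, inv_mul_cancel₀ hn]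
    refine (compressedDet_le_mul hR (s := s) (x := ‖a - p‖⁻¹ • (a - p)) hx1
      (Submodule.smul_mem _ _ ho) ?_).trans
      (mul_le_of_le_one_right (compressedDet_pos hR s).le (sub_le_self _ (sq_nonneg _)))
    rw [hspan, Submodule.span_singleton_smul_eq (IsUnit.mk0 _ (inv_ne_zero hn))]
    refine le_antisymm (sup_le le_sup_left ?_) (sup_le le_sup_left ?_)
    · rw [Submodule.span_singleton_le_iff_mem]
      have := Submodule.add_mem_sup (S := V) (T := Submodule.span ℝ {a - p}) hpV
        (Submodule.mem_span_singleton_self _)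
      simpa using this
    · rw [Submodule.span_singleton_le_iff_mem, sub_eq_add_neg, add_comm]
      exact Submodule.add_mem_sup (V.neg_mem hpV) (Submodule.mem_span_singleton_self _)

/-- A decreasing net bounded below by 0 converges, so `limUnder` is here a genuine limit and not a
default value. -/
theorem tendsto_compressedDet {R : H →L[ℝ] H} (hR : ‖R‖ < 1) :
    Tendsto (compressedDet (-(adjoint R ∘L R))) atTop (𝓝 (fredholmDet (-(adjoint R ∘L R)))) :=
  tendsto_nhds_limUnder ⟨_, tendsto_atTop_ciInf (compressedDet_antitone hR)
    ⟨0, by rintro _ ⟨s, rfl⟩; exact (compressedDet_pos hR s).le⟩⟩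

theorem fredholmDet_le_compressedDet {R : H →L[ℝ] H} (hR : ‖R‖ < 1) (s : Finset H) :
    fredholmDet (-(adjoint R ∘L R)) ≤ compressedDet (-(adjoint R ∘L R)) s :=
  (compressedDet_antitone hR).le_of_tendsto (tendsto_compressedDet hR) s

/-- Hadamard's inequality for the Fredholm determinant. -/
theorem fredholmDet_le_prod {ι : Type*} {R : H →L[ℝ] H} (hR : ‖R‖ < 1) {v : ι → H}
    (hv : Orthonormal ℝ v) (s : Finset ι) :
    fredholmDet (-(adjoint R ∘L R)) ≤ ∏ i ∈ s, (1 - ‖R (v i)‖ ^ 2) := by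
  classical
  refine (fredholmDet_le_compressedDet hR (s.image v)).trans ?_
  induction s using Finset.induction_on with
  | empty =>
    refine ((compressedDet_eq_det _ _ (fun i : Empty => i.elim) (Orthonormal.of_isEmpty _)
      (by simp)).trans ?_).le
    simp
  | insert a s ha ih =>
    rw [Finset.prod_insert ha, mul_comm]
    have hsub : 0 ≤ 1 - ‖R (v a)‖ ^ 2 :=
      (sub_pos.2 ((norm_sq_apply_le (hv.1 a)).trans_lt (norm_sq_lt_one hR))).le
    refine (compressedDet_le_mul hR (s := s.image v) (hv.1 a) ?_ ?_).trans
      (mul_le_mul_of_nonneg_right ih hsub)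
    · rw [Submodule.mem_orthogonal]
      intro u hu
      induction hu using Submodule.span_induction with
      | mem x hx =>
        obtain ⟨i, hi, rfl⟩ := Finset.mem_image.1 (Finset.mem_coe.1 hx)
        exact hv.2 fun h => ha (h ▸ hi)
      | zero => simp
      | add x y _ _ hx hy => rw [inner_add_left, hx, hy, add_zero]
      | smul c x _ hx => rw [inner_smul_left, hx, mul_zero]
    · rw [Finset.image_insert, Finset.coe_insert, Submodule.span_insert, sup_comm]

theorem le_fredholmDet {R : H →L[ℝ] H} (hR : ‖R‖ < 1) {c : ℝ}
    (hc : ∀ (n : ℕ) (v : Fin n → H), Orthonormal ℝ v → c ≤ ∏ i, (1 - ‖R (v i)‖ ^ 2)) :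
    c ≤ fredholmDet (-(adjoint R ∘L R)) := by
  refine ge_of_tendsto' (tendsto_compressedDet hR) fun s => ?_
  obtain ⟨n, v, hv, h⟩ := exists_orthonormal_compressedDet_eq_prod R s
  exact h ▸ hc n v hv

/-! ### Hilbert bases and diagonal operators -/

section Diagonal

variable {ι κ : Type*}

theorem _root_.HilbertBasis.ext_clm (b : HilbertBasis ι ℝ H) {S T : H →L[ℝ] H}
    (h : ∀ i, S (b i) = T (b i)) : S = T :=
  ContinuousLinearMap.ext_on
    (Submodule.dense_iff_topologicalClosure_eq_top.2 b.dense_span)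
    (by rintro _ ⟨i, rfl⟩; exact h i)

theorem _root_.HilbertBasis.ext_inner (b : HilbertBasis ι ℝ H) {x y : H}
    (h : ∀ i, ⟪b i, x⟫_ℝ = ⟪b i, y⟫_ℝ) : x = y := by
  apply b.repr.injective
  ext i
  rw [b.repr_apply_apply, b.repr_apply_apply, h i]

theorem _root_.HilbertBasis.hasSum_inner_sq (b : HilbertBasis ι ℝ H) (x : H) :
    HasSum (fun i => ⟪b i, x⟫_ℝ ^ 2) (‖x‖ ^ 2) := by
  have h := b.hasSum_inner_mul_inner x x
  rw [real_inner_self_eq_norm_sq] at h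
  refine h.congr_fun fun i => ?_
  rw [real_inner_comm, sq]

variable {b : HilbertBasis ι ℝ H} {K : H →L[ℝ] H} {μ : ι → ℝ}

theorem isSelfAdjoint_of_diagonal (hb : ∀ i, K (b i) = μ i • b i) : IsSelfAdjoint K := by
  classical
  rw [isSelfAdjoint_iff']
  refine b.ext_clm fun i => b.ext_inner fun k => ?_
  rw [adjoint_inner_right, hb, hb, inner_smul_right, real_inner_smul_left,
    orthonormal_iff_ite.1 b.orthonormal]
  split_ifs with h
  · rw [h]
  · simp

theorem inner_apply_of_diagonal (hb : ∀ i, K (b i) = μ i • b i) (i : ι) (x : H) :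
    ⟪b i, K x⟫_ℝ = μ i * ⟪b i, x⟫_ℝ := by
  have h : ⟪K (b i), x⟫_ℝ = ⟪b i, K x⟫_ℝ := (isSelfAdjoint_of_diagonal hb).isSymmetric _ _
  rw [← h, hb, real_inner_smul_left]

theorem hasSum_inner_apply_of_diagonal (hb : ∀ i, K (b i) = μ i • b i) (x : H) :
    HasSum (fun i => μ i * ⟪b i, x⟫_ℝ ^ 2) ⟪x, K x⟫_ℝ := by
  refine (b.hasSum_inner_mul_inner x (K x)).congr_fun fun i => ?_
  rw [inner_apply_of_diagonal hb, real_inner_comm x]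
  ring

theorem hasSum_norm_sq_apply_of_diagonal (hb : ∀ i, K (b i) = μ i • b i) (x : H) :
    HasSum (fun i => μ i ^ 2 * ⟪b i, x⟫_ℝ ^ 2) (‖K x‖ ^ 2) := by
  refine (b.hasSum_inner_sq (K x)).congr_fun fun i => ?_
  rw [inner_apply_of_diagonal hb, mul_pow]

theorem isPositive_of_diagonal (hb : ∀ i, K (b i) = μ i • b i) (hμ : ∀ i, 0 ≤ μ i) :
    K.IsPositive := by
  refine ContinuousLinearMap.isPositive_def.2
    ⟨(isSelfAdjoint_of_diagonal hb).isSymmetric, fun x => ?_⟩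
  rw [reApplyInnerSelf_apply, RCLike.re_to_real, real_inner_comm]
  exact (hasSum_inner_apply_of_diagonal hb x).nonneg fun i => mul_nonneg (hμ i) (sq_nonneg _)

theorem norm_le_of_diagonal (hb : ∀ i, K (b i) = μ i • b i) {c : ℝ} (hc : 0 ≤ c)
    (hμ : ∀ i, |μ i| ≤ c) : ‖K‖ ≤ c := by
  refine K.opNorm_le_bound hc fun x => ?_
  refine abs_le_of_sq_le_sq' ?_ (by positivity) |>.2
  rw [mul_pow]
  refine hasSum_le (fun i => ?_) (hasSum_norm_sq_apply_of_diagonal hb x)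
    ((b.hasSum_inner_sq x).mul_left (c ^ 2))
  exact mul_le_mul_of_nonneg_right (sq_le_sq' (abs_le.1 (hμ i)).1 (abs_le.1 (hμ i)).2)
    (sq_nonneg _)

/-- By Parseval ∑ₗ ⟪b i, e l⟫² = 1, so each finite sum of the μ i is dominated by the trace computed
in the basis e. -/
theorem summable_of_summable_inner (hb : ∀ i, K (b i) = μ i • b i) (hμ : ∀ i, 0 ≤ μ i)
    (e : HilbertBasis κ ℝ H) (h : Summable fun l => ⟪e l, K (e l)⟫_ℝ) : Summable μ := by
  refine summable_of_sum_le hμ (c := ∑' l, ⟪e l, K (e l)⟫_ℝ) fun s => ?_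
  have h1 : HasSum (fun l => ∑ i ∈ s, μ i * ⟪b i, e l⟫_ℝ ^ 2) (∑ i ∈ s, μ i) := by
    refine hasSum_sum fun i _ => ?_
    have h2 := (e.hasSum_inner_sq (b i)).mul_left (μ i)
    rw [b.orthonormal.1 i, one_pow, mul_one] at h2
    simpa only [real_inner_comm] using h2
  refine hasSum_le (fun l => ?_) h1 h.hasSum
  exact sum_le_hasSum s (fun i _ => mul_nonneg (hμ i) (sq_nonneg _))
    (hasSum_inner_apply_of_diagonal hb (e l))

/-- Basis independence of the trace: the double family μ i ⟪b i, e l⟫ ⟪e l, R b i⟫ is summed in both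
orders. -/
theorem hasSum_inner_comp_of_diagonal (hb : ∀ i, K (b i) = μ i • b i) (hμ : ∀ i, 0 ≤ μ i)
    (hs : Summable μ) (e : HilbertBasis κ ℝ H) (R : H →L[ℝ] H) :
    HasSum (fun l => ⟪e l, R (K (e l))⟫_ℝ) (∑' i, μ i * ⟪b i, R (b i)⟫_ℝ) := by
  set F : ι × κ → ℝ := fun p => μ p.1 * (⟪b p.1, e p.2⟫_ℝ * ⟪e p.2, R (b p.1)⟫_ℝ) with hF
  -- Majorant for Fubini: |xy| ≤ x² + y², and Parseval bounds the row sums by μ i (1 + ‖R‖²).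
  have hG1 : ∀ i, HasSum (fun l => μ i * (⟪e l, b i⟫_ℝ ^ 2 + ⟪e l, R (b i)⟫_ℝ ^ 2))
      (μ i * (‖b i‖ ^ 2 + ‖R (b i)‖ ^ 2)) := fun i =>
    ((e.hasSum_inner_sq (b i)).add (e.hasSum_inner_sq (R (b i)))).mul_left (μ i)
  have hG : Summable fun p : ι × κ =>
      μ p.1 * (⟪e p.2, b p.1⟫_ℝ ^ 2 + ⟪e p.2, R (b p.1)⟫_ℝ ^ 2) := by
    refine (summable_prod_of_nonneg fun p => mul_nonneg (hμ _) (by positivity)).2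
      ⟨fun i => (hG1 i).summable, ?_⟩
    refine Summable.of_nonneg_of_le (fun i => tsum_nonneg fun l => mul_nonneg (hμ _) (by positivity))
      (fun i => ?_) (hs.mul_right (1 + ‖R‖ ^ 2))
    rw [(hG1 i).tsum_eq, b.orthonormal.1 i, one_pow]
    exact mul_le_mul_of_nonneg_left
      (add_le_add le_rfl (norm_sq_apply_le (b.orthonormal.1 i))) (hμ i)
  have hFs : Summable F := by
    refine Summable.of_norm_bounded hG fun p => ?_
    rw [hF, Real.norm_eq_abs, abs_mul, abs_of_nonneg (hμ _), abs_mul,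
      real_inner_comm (e p.2) (b p.1)]
    refine mul_le_mul_of_nonneg_left ?_ (hμ _)
    rw [← sq_abs ⟪e p.2, b p.1⟫_ℝ, ← sq_abs ⟪e p.2, R (b p.1)⟫_ℝ]
    nlinarith [sq_nonneg (|⟪e p.2, b p.1⟫_ℝ| - |⟪e p.2, R (b p.1)⟫_ℝ|),
      sq_nonneg |⟪e p.2, b p.1⟫_ℝ|, sq_nonneg |⟪e p.2, R (b p.1)⟫_ℝ|]
  have h1 : HasSum (fun i => μ i * ⟪b i, R (b i)⟫_ℝ) (∑' p, F p) :=
    hFs.hasSum.prod_fiberwise fun i => (e.hasSum_inner_mul_inner (b i) (R (b i))).mul_left (μ i)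
  rw [h1.tsum_eq]
  refine ((Equiv.prodComm κ ι).hasSum_iff.2 hFs.hasSum).prod_fiberwise fun l => ?_
  rw [← adjoint_inner_left]
  refine (b.hasSum_inner_mul_inner (adjoint R (e l)) (K (e l))).congr_fun fun i => ?_
  rw [inner_apply_of_diagonal hb, adjoint_inner_left]
  simp only [hF, Function.comp, Equiv.prodComm_apply, Prod.swap]
  ring

theorem trace_comp_of_diagonal (hb : ∀ i, K (b i) = μ i • b i) (hμ : ∀ i, 0 ≤ μ i)
    (hs : Summable μ) (R : H →L[ℝ] H) : trace (R ∘L K) = ∑' i, μ i * ⟪b i, R (b i)⟫_ℝ :=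
  (hasSum_inner_comp_of_diagonal hb hμ hs (onb H) R).tsum_eq

theorem trace_of_diagonal (hb : ∀ i, K (b i) = μ i • b i) (hμ : ∀ i, 0 ≤ μ i)
    (hs : Summable μ) : trace K = ∑' i, μ i := by
  have h := trace_comp_of_diagonal hb hμ hs (ContinuousLinearMap.id ℝ H)
  rw [ContinuousLinearMap.id_comp] at h
  rw [h]
  refine tsum_congr fun i => ?_
  rw [ContinuousLinearMap.id_apply, real_inner_self_eq_norm_sq, b.orthonormal.1 i]
  ring

/-- Expand ‖S* v j‖² in the basis e, exchange sums, and apply Bessel to each S (e l). Applying this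
twice transfers Hilbert–Schmidt summability from one basis to any orthonormal family. -/
theorem sum_norm_sq_adjoint_le (e : HilbertBasis κ ℝ H) {S : H →L[ℝ] H}
    (hS : Summable fun l => ‖S (e l)‖ ^ 2) {v : ι → H} (hv : Orthonormal ℝ v) (s : Finset ι) :
    ∑ j ∈ s, ‖adjoint S (v j)‖ ^ 2 ≤ ∑' l, ‖S (e l)‖ ^ 2 := by
  refine hasSum_le (fun l => ?_)
    (hasSum_sum fun j _ => e.hasSum_inner_sq (adjoint S (v j))) hS.hasSum
  refine le_trans (le_of_eq ?_) (hv.sum_inner_products_le (S (e l)) (s := s))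
  refine Finset.sum_congr rfl fun j _ => ?_
  rw [adjoint_inner_right, Real.norm_eq_abs, sq_abs, real_inner_comm]

end Diagonal

/-! ### The spectral calculus on eigenvectors -/

theorem eigenProj_apply_of_eigenvector {A : H →L[ℝ] H} (hA : IsSelfAdjoint A) {e : H} {ν : ℝ}
    (he : A e = ν • e) : eigenProj A ν e = e ∧ ∀ μ ≠ ν, eigenProj A μ e = 0 := by
  have hmem : e ∈ (A - ν • ContinuousLinearMap.id ℝ H).ker := by
    simp [he]
  refine ⟨Submodule.starProjection_eq_self_iff.2 hmem, fun μ hμ => ?_⟩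
  refine (Submodule.starProjection_apply_eq_zero_iff _).2 fun u hu => ?_
  exact eigenProj_orthogonalFamily hA hμ ⟨u, hu⟩ ⟨e, hmem⟩

theorem spectralCalculus_apply_of_eigenvector {A : H →L[ℝ] H} (hA : IsSelfAdjoint A) {f : ℝ → ℝ}
    {C : ℝ} (hf : ∀ μ : ℝ, (A - μ • ContinuousLinearMap.id ℝ H).ker ≠ ⊥ → |f μ| ≤ C) {e : H} {ν : ℝ}
    (he : A e = ν • e) : spectralCalculus f A e = f ν • e := by
  obtain ⟨h1, h2⟩ := eigenProj_apply_of_eigenvector hA he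
  refine (hasSum_spectralCalculus hA f C hf e).unique ?_
  have h := hasSum_single (f := fun μ : ℝ => f μ • eigenProj A μ e) ν fun μ hμ => by
    rw [h2 μ hμ, smul_zero]
  rwa [h1] at h

theorem eigenvalue_nonneg_and_le {A : H →L[ℝ] H} (hA : A.IsPositive) {μ : ℝ}
    (hμ : (A - μ • ContinuousLinearMap.id ℝ H).ker ≠ ⊥) : 0 ≤ μ ∧ μ ≤ ‖A‖ := by
  obtain ⟨x, hx, hx0⟩ := Submodule.exists_mem_ne_zero_of_ne_bot hμ
  have hAx : A x = μ • x := by simpa [sub_eq_zero] using hx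
  have hn : 0 < ‖x‖ := norm_pos_iff.2 hx0
  have h0 : 0 ≤ μ := by
    have h := hA.inner_nonneg_right x
    rw [hAx, inner_smul_right, real_inner_self_eq_norm_sq] at h
    exact nonneg_of_mul_nonneg_left h (by positivity)
  refine ⟨h0, ?_⟩
  have h := A.le_opNorm x
  rw [hAx, norm_smul, Real.norm_eq_abs, abs_of_nonneg h0] at h
  exact le_of_mul_le_mul_right h hn

/-- The spectral theorem for compact self-adjoint operators. -/
theorem exists_hilbertBasis_eigenvectors.{u} {H : Type u} [NormedAddCommGroup H]
    [InnerProductSpace ℝ H] [CompleteSpace H] {A : H →L[ℝ] H} (hA : IsSelfAdjoint A)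
    (hc : IsCompactOperator A) :
    ∃ (ι : Type u) (b : HilbertBasis ι ℝ H) (μ : ι → ℝ), ∀ i, A (b i) = μ i • b i := by
  set E : ℝ → Submodule ℝ H := fun μ => (A - μ • ContinuousLinearMap.id ℝ H).ker with hE
  have hcpl : ∀ μ, CompleteSpace (E μ) := fun μ =>
    (ContinuousLinearMap.isClosed_ker (A - μ • ContinuousLinearMap.id ℝ H)).completeSpace_coe
  choose w c hw using fun μ => exists_hilbertBasis ℝ (E μ)
  have hE' : ∀ μ, E μ = Module.End.eigenspace (A : H →ₗ[ℝ] H) μ := by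
    intro μ
    ext x
    simp [hE, sub_eq_zero]
  have ho : Orthonormal ℝ fun a : Σ μ, w μ => ((c a.1 a.2 : E a.1) : H) :=
    (eigenProj_orthogonalFamily hA).orthonormal_sigma_orthonormal fun μ => (c μ).orthonormal
  -- A vector orthogonal to the chosen bases of all eigenspaces is orthogonal to every eigenspace,
  -- hence zero by compactness.
  have hbot : (Submodule.span ℝ (Set.range fun a : Σ μ, w μ => ((c a.1 a.2 : E a.1) : H)))ᗮ = ⊥ := by
    rw [eq_bot_iff, ← orthogonalComplement_iSup_eigenspaces_eq_bot hc hA.isSymmetric]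
    intro x hx
    rw [← Submodule.iInf_orthogonal, Submodule.mem_iInf]
    intro μ
    rw [← hE', ← Submodule.starProjection_apply_eq_zero_iff]
    have h0 : (E μ).orthogonalProjectionOnto x = 0 := by
      refine (c μ).ext_inner fun i => ?_
      rw [inner_zero_right, Submodule.inner_orthogonalProjectionOnto_eq_of_mem_left]
      exact hx _ (Submodule.subset_span ⟨⟨μ, i⟩, rfl⟩)
    rw [Submodule.starProjection_apply, h0]
    rfl
  refine ⟨_, HilbertBasis.mkOfOrthogonalEqBot ho hbot, fun a => a.1, fun a => ?_⟩
  rw [HilbertBasis.coe_mkOfOrthogonalEqBot]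
  have h := (c a.1 a.2 : E a.1).2
  simpa [hE, sub_eq_zero] using h

/-! ### Schatten classes -/

theorem absPow_apply_of_eigenvector {p : ℝ} (hp : 0 ≤ p) {K : H →L[ℝ] H} {e : H} {ν : ℝ}
    (he : (adjoint K ∘L K) e = ν • e) : absPow p K e = ν ^ (p / 2) • e := by
  have hpos := isPositive_adjoint_comp_self K
  refine spectralCalculus_apply_of_eigenvector hpos.isSelfAdjoint
    (C := ‖adjoint K ∘L K‖ ^ (p / 2)) (fun μ hμ => ?_) he
  obtain ⟨h0, h1⟩ := eigenvalue_nonneg_and_le hpos hμ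
  rw [abs_of_nonneg (Real.rpow_nonneg h0 _)]
  exact Real.rpow_le_rpow h0 h1 (by positivity)

/-- Compactness supplies an eigenbasis on which both sides agree; the eigenspace series alone would
miss continuous spectrum. -/
theorem absPow_two {K : H →L[ℝ] H} (hK : IsCompactOperator K) : absPow 2 K = adjoint K ∘L K := by
  obtain ⟨ι, b, μ, hb⟩ := exists_hilbertBasis_eigenvectors
    (isPositive_adjoint_comp_self K).isSelfAdjoint (hK.clm_comp (adjoint K))
  refine b.ext_clm fun i => ?_
  rw [absPow_apply_of_eigenvector zero_le_two (hb i), hb]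
  simp

theorem absPow_one_of_isPositive {K : H →L[ℝ] H} (hK : IsCompactOperator K) (hp : K.IsPositive) :
    absPow 1 K = K := by
  obtain ⟨ι, b, μ, hb⟩ := exists_hilbertBasis_eigenvectors hp.isSelfAdjoint hK
  refine b.ext_clm fun i => ?_
  have h0 : 0 ≤ μ i := by
    have h := hp.inner_nonneg_right (b i)
    rwa [hb, inner_smul_right, real_inner_self_eq_norm_sq, b.orthonormal.1 i, one_pow,
      mul_one] at h
  have he : (adjoint K ∘L K) (b i) = (μ i ^ 2) • b i := by
    rw [isSelfAdjoint_iff'.1 hp.isSelfAdjoint, comp_apply, hb, map_smul, hb, smul_smul, sq]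
  rw [absPow_apply_of_eigenvector zero_le_one he, hb, ← Real.sqrt_eq_rpow, Real.sqrt_sq h0]

theorem isSchatten_two_iff {K : H →L[ℝ] H} :
    IsSchatten 2 K ↔ IsCompactOperator K ∧ Summable fun l => ‖K (onb H l)‖ ^ 2 := by
  refine and_congr_right fun hK => ?_
  rw [absPow_two hK]
  refine summable_congr fun l => ?_
  rw [comp_apply, adjoint_inner_right, real_inner_self_eq_norm_sq]

theorem isSchatten_one_iff {K : H →L[ℝ] H} (hp : K.IsPositive) :
    IsSchatten 1 K ↔ IsCompactOperator K ∧ Summable fun l => ⟪onb H l, K (onb H l)⟫_ℝ := by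
  refine and_congr_right fun hK => ?_
  rw [absPow_one_of_isPositive hK hp]

theorem schattenNorm_one {K : H →L[ℝ] H} (hK : IsCompactOperator K) (hp : K.IsPositive) :
    schattenNorm 1 K = trace K := by
  rw [schattenNorm, absPow_one_of_isPositive hK hp, div_one, Real.rpow_one]

theorem sum_norm_sq_le {ι : Type*} {R : H →L[ℝ] H} (hR : IsSchatten 2 R) {v : ι → H}
    (hv : Orthonormal ℝ v) (s : Finset ι) :
    ∑ j ∈ s, ‖R (v j)‖ ^ 2 ≤ ∑' l, ‖adjoint R (onb H l)‖ ^ 2 := by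
  have h := (isSchatten_two_iff.1 hR).2
  have h1 : Summable fun l => ‖adjoint R (onb H l)‖ ^ 2 :=
    summable_of_sum_le (fun _ => sq_nonneg _)
      (sum_norm_sq_adjoint_le (onb H) h (onb H).orthonormal)
  simpa only [adjoint_adjoint] using sum_norm_sq_adjoint_le (onb H) h1 hv s

theorem summable_norm_sq {ι : Type*} {R : H →L[ℝ] H} (hR : IsSchatten 2 R) {v : ι → H}
    (hv : Orthonormal ℝ v) : Summable fun i => ‖R (v i)‖ ^ 2 :=
  summable_of_sum_le (fun _ => sq_nonneg _) (sum_norm_sq_le hR hv)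

/-! ### Scalar inequalities -/

section Scalar

variable {ε x : ℝ}

theorem shrinkage_denom_pos (hε : 0 < ε) (x : ℝ) : 0 < √(4 * x ^ 2 + ε ^ 2) + ε :=
  add_pos_of_nonneg_of_pos (Real.sqrt_nonneg _) hε

theorem shrinkage_nonneg (hε : 0 < ε) (hx : 0 ≤ x) : 0 ≤ shrinkage ε x :=
  div_nonneg (by positivity) (shrinkage_denom_pos hε x).le

theorem shrinkage_le (hε : 0 < ε) (hx : 0 ≤ x) : shrinkage ε x ≤ 2 * x / (2 * x + ε) := by
  refine div_le_div_of_nonneg_left (by positivity) (by positivity) ?_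
  have h : 2 * x ≤ √(4 * x ^ 2 + ε ^ 2) := Real.le_sqrt_of_sq_le (by nlinarith [sq_nonneg ε])
  linarith

/-- The bound 2x/(2x + ε) increases with x, so N = ‖K‖ bounds every eigenvalue of f_ε(K) by one
constant below 1. -/
theorem shrinkage_le_of_le (hε : 0 < ε) (hx : 0 ≤ x) {N : ℝ} (hN : x ≤ N) :
    shrinkage ε x ≤ 2 * N / (2 * N + ε) := by
  refine (shrinkage_le hε hx).trans ?_
  have hN0 := hx.trans hN
  rw [div_le_div_iff₀ (by positivity) (by positivity)]
  nlinarith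

theorem two_mul_div_two_mul_add_lt_one (hε : 0 < ε) (hx : 0 ≤ x) : 2 * x / (2 * x + ε) < 1 := by
  rw [div_lt_one (by positivity)]
  linarith

theorem shrinkage_lt_one (hε : 0 < ε) (hx : 0 ≤ x) : shrinkage ε x < 1 :=
  (shrinkage_le hε hx).trans_lt (two_mul_div_two_mul_add_lt_one hε hx)

theorem shrinkage_le_div (hε : 0 < ε) (hx : 0 ≤ x) : shrinkage ε x ≤ 2 / ε * x := by
  rw [div_mul_eq_mul_div]
  exact div_le_div_of_nonneg_left (by positivity) hε (le_add_of_nonneg_left (Real.sqrt_nonneg _))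

/-- The stationarity equation characterising the shrinkage function. -/
theorem mul_one_sub_shrinkage_sq (hε : 0 < ε) (x : ℝ) :
    x * (1 - shrinkage ε x ^ 2) = ε * shrinkage ε x := by
  have hd := shrinkage_denom_pos hε x
  have hs := Real.sq_sqrt (show 0 ≤ 4 * x ^ 2 + ε ^ 2 by positivity)
  unfold shrinkage
  generalize √(4 * x ^ 2 + ε ^ 2) = y at hs hd
  field_simp
  linear_combination x * hs

theorem log_le_log_add_div {a c : ℝ} (ha : 0 < a) (hc : 0 < c) :
    Real.log a ≤ Real.log c + (a - c) / c := by
  have h := Real.log_le_sub_one_of_pos (div_pos ha hc)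
  rw [Real.log_div ha.ne' hc.ne'] at h
  rw [sub_div, div_self hc.ne']
  linarith

/-- Used with r = ⟪b i, R b i⟫ and t = ‖R b i‖², so that the quantity in `h0` is ‖R b i - f b i‖².
The tangent of log at 1 - f² leaves exactly ε/(1 - f²) times this quantity as gap, and 1/(1 - f²) ≥
1. -/
theorem scalar_profit_le (hε : 0 < ε) (hx : 0 ≤ x) {r t : ℝ} (ht : t < 1)
    (h0 : 0 ≤ t - 2 * shrinkage ε x * r + shrinkage ε x ^ 2) :
    2 * (x * r) + ε * Real.log (1 - t) + ε * (t - 2 * shrinkage ε x * r + shrinkage ε x ^ 2) ≤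
      2 * (x * shrinkage ε x) + ε * Real.log (1 - shrinkage ε x ^ 2) := by
  have hst := mul_one_sub_shrinkage_sq hε x
  have hf0 := shrinkage_nonneg hε hx
  have hf1 := shrinkage_lt_one hε hx
  set f := shrinkage ε x
  have hq : 0 < 1 - f ^ 2 := by nlinarith
  have hx' : x = ε * f / (1 - f ^ 2) := by rw [eq_div_iff hq.ne', hst]
  have hlog := log_le_log_add_div (sub_pos.2 ht) hq
  have h1 : ε * (t - 2 * f * r + f ^ 2) ≤ ε * (t - 2 * f * r + f ^ 2) / (1 - f ^ 2) := by
    rw [le_div_iff₀ hq]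
    exact mul_le_of_le_one_right (by positivity) (by nlinarith)
  have h2 : 2 * (x * r) + ε * ((1 - t - (1 - f ^ 2)) / (1 - f ^ 2)) +
      ε * (t - 2 * f * r + f ^ 2) / (1 - f ^ 2) = 2 * (x * f) := by
    rw [hx']
    field_simp
    ring
  have h3 := mul_le_mul_of_nonneg_left hlog hε.le
  linarith

theorem neg_div_le_log_one_sub {t c : ℝ} (ht0 : 0 ≤ t) (htc : t ≤ c) (hc : c < 1) :
    -(t / (1 - c)) ≤ Real.log (1 - t) := by
  have ht : 0 < 1 - t := by linarith
  have h := Real.one_sub_inv_le_log_of_pos ht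
  refine le_trans ?_ h
  have h1 : 1 - (1 - t)⁻¹ = -(t / (1 - t)) := by field_simp; ring
  rw [h1]
  exact neg_le_neg (div_le_div_of_nonneg_left ht0 (by linarith) (by linarith))

end Scalar
/-! ### Logarithms of Fredholm determinants -/

section LogDet

variable {ι : Type*} {R : H →L[ℝ] H}

theorem one_sub_norm_sq_pos (hR : ‖R‖ < 1) {x : H} (hx : ‖x‖ = 1) : 0 < 1 - ‖R x‖ ^ 2 :=
  sub_pos.2 ((norm_sq_apply_le hx).trans_lt (norm_sq_lt_one hR))

theorem neg_div_le_log_one_sub_norm_sq (hR : ‖R‖ < 1) {x : H} (hx : ‖x‖ = 1) :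
    -(‖R x‖ ^ 2 / (1 - ‖R‖ ^ 2)) ≤ Real.log (1 - ‖R x‖ ^ 2) :=
  neg_div_le_log_one_sub (sq_nonneg _) (norm_sq_apply_le hx) (norm_sq_lt_one hR)

theorem log_one_sub_norm_sq_nonpos (hR : ‖R‖ < 1) {x : H} (hx : ‖x‖ = 1) :
    Real.log (1 - ‖R x‖ ^ 2) ≤ 0 :=
  Real.log_nonpos (one_sub_norm_sq_pos hR hx).le (sub_le_self _ (sq_nonneg _))

theorem summable_log_one_sub_norm_sq (hR : ‖R‖ < 1) (h2 : IsSchatten 2 R) {v : ι → H}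
    (hv : Orthonormal ℝ v) : Summable fun i => Real.log (1 - ‖R (v i)‖ ^ 2) := by
  refine Summable.of_norm_bounded ((summable_norm_sq h2 hv).div_const (1 - ‖R‖ ^ 2)) fun i => ?_
  rw [Real.norm_eq_abs, abs_of_nonpos (log_one_sub_norm_sq_nonpos hR (hv.1 i)), neg_le]
  exact neg_div_le_log_one_sub_norm_sq hR (hv.1 i)

theorem prod_one_sub_norm_sq_eq_exp (hR : ‖R‖ < 1) {v : ι → H} (hv : Orthonormal ℝ v)
    (s : Finset ι) :
    ∏ i ∈ s, (1 - ‖R (v i)‖ ^ 2) = Real.exp (∑ i ∈ s, Real.log (1 - ‖R (v i)‖ ^ 2)) := by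
  rw [Real.exp_sum]
  exact Finset.prod_congr rfl fun i _ => (Real.exp_log (one_sub_norm_sq_pos hR (hv.1 i))).symm

/-- The Hilbert–Schmidt bound on ∑ ‖R v i‖² is uniform over orthonormal v, so all compressions stay
above one positive constant. Positivity keeps `Real.log` away from its default value at 0. -/
theorem fredholmDet_pos (hR : ‖R‖ < 1) (h2 : IsSchatten 2 R) :
    0 < fredholmDet (-(adjoint R ∘L R)) := by
  have hc : 0 < 1 - ‖R‖ ^ 2 := sub_pos.2 (norm_sq_lt_one hR)
  refine (Real.exp_pos (-((∑' l, ‖adjoint R (onb H l)‖ ^ 2) / (1 - ‖R‖ ^ 2)))).trans_le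
    (le_fredholmDet hR fun n v hv => ?_)
  rw [prod_one_sub_norm_sq_eq_exp hR hv, Real.exp_le_exp]
  refine le_trans ?_
    (Finset.sum_le_sum fun i _ => neg_div_le_log_one_sub_norm_sq hR (hv.1 i))
  rw [Finset.sum_neg_distrib, ← Finset.sum_div]
  exact neg_le_neg (div_le_div_of_nonneg_right (sum_norm_sq_le h2 hv _) hc.le)

theorem log_fredholmDet_le_tsum (hR : ‖R‖ < 1) (h2 : IsSchatten 2 R) {v : ι → H}
    (hv : Orthonormal ℝ v) :
    Real.log (fredholmDet (-(adjoint R ∘L R))) ≤ ∑' i, Real.log (1 - ‖R (v i)‖ ^ 2) := by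
  refine ge_of_tendsto' (summable_log_one_sub_norm_sq hR h2 hv).hasSum fun s => ?_
  rw [Real.log_le_iff_le_exp (fredholmDet_pos hR h2), ← prod_one_sub_norm_sq_eq_exp hR hv]
  exact fredholmDet_le_prod hR hv s

/-- Jensen's inequality for a diagonal contraction. -/
theorem tsum_mul_log_le_of_diagonal (hR : ‖R‖ < 1) {b : HilbertBasis ι ℝ H} {ρ : ι → ℝ}
    (hb : ∀ i, R (b i) = ρ i • b i)
    (hs : Summable fun i => Real.log (1 - ‖R (b i)‖ ^ 2)) {x : H} (hx : ‖x‖ = 1) :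
    (Summable fun i => ⟪b i, x⟫_ℝ ^ 2 * Real.log (1 - ‖R (b i)‖ ^ 2)) ∧
    ∑' i, ⟪b i, x⟫_ℝ ^ 2 * Real.log (1 - ‖R (b i)‖ ^ 2) ≤ Real.log (1 - ‖R x‖ ^ 2) := by
  have hw : ∀ i, ⟪b i, x⟫_ℝ ^ 2 ≤ 1 := fun i => by
    have h := abs_real_inner_le_norm (b i) x
    rw [b.orthonormal.1 i, hx, one_mul] at h
    exact sq_le_one_iff_abs_le_one _ |>.2 h
  have hsum : Summable fun i => ⟪b i, x⟫_ℝ ^ 2 * Real.log (1 - ‖R (b i)‖ ^ 2) := by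
    refine Summable.of_norm_bounded hs.norm fun i => ?_
    rw [norm_mul, Real.norm_eq_abs, abs_of_nonneg (sq_nonneg _)]
    exact mul_le_of_le_one_left (norm_nonneg _) (hw i)
  refine ⟨hsum, ?_⟩
  have hρ : ∀ i, ‖R (b i)‖ ^ 2 = ρ i ^ 2 := fun i => by
    rw [hb, norm_smul, b.orthonormal.1 i, mul_one, Real.norm_eq_abs, sq_abs]
  have hq := one_sub_norm_sq_pos hR hx
  set T := ‖R x‖ ^ 2 with hT
  have h1 := b.hasSum_inner_sq x
  rw [hx, one_pow] at h1
  -- The tangent of log at 1 - T is averaged with weights ⟪b i, x⟫² of total mass 1; the linear term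
  -- vanishes because ρ i² has mean T.
  have h2 := (h1.mul_right (Real.log (1 - T))).add
    (((h1.mul_right T).sub (hasSum_norm_sq_apply_of_diagonal hb x)).div_const (1 - T))
  rw [one_mul, one_mul, ← hT, sub_self, zero_div, add_zero] at h2
  refine hasSum_le (fun i => ?_) hsum.hasSum h2
  have h3 := mul_le_mul_of_nonneg_left
    (log_le_log_add_div (one_sub_norm_sq_pos hR (b.orthonormal.1 i)) hq) (sq_nonneg ⟪b i, x⟫_ℝ)
  rw [hρ] at h3 ⊢
  refine h3.trans (le_of_eq ?_)
  ring

/-- Apply Jensen to each vector of an orthonormal family v and sum over v. By Bessel each b i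
receives total weight at most 1, and the logarithms are nonpositive. -/
theorem tsum_log_le_log_fredholmDet (hR : ‖R‖ < 1) {b : HilbertBasis ι ℝ H} {ρ : ι → ℝ}
    (hb : ∀ i, R (b i) = ρ i • b i)
    (hs : Summable fun i => Real.log (1 - ‖R (b i)‖ ^ 2)) :
    ∑' i, Real.log (1 - ‖R (b i)‖ ^ 2) ≤ Real.log (fredholmDet (-(adjoint R ∘L R))) := by
  have h : Real.exp (∑' i, Real.log (1 - ‖R (b i)‖ ^ 2)) ≤
      fredholmDet (-(adjoint R ∘L R)) := by
    refine le_fredholmDet hR fun n v hv => ?_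
    rw [prod_one_sub_norm_sq_eq_exp hR hv, Real.exp_le_exp]
    refine le_trans ?_ (Finset.sum_le_sum fun j _ =>
      (tsum_mul_log_le_of_diagonal hR hb hs (hv.1 j)).2)
    refine hasSum_le (fun i => ?_) hs.hasSum (hasSum_sum fun j _ =>
      (tsum_mul_log_le_of_diagonal hR hb hs (hv.1 j)).1.hasSum)
    rw [← Finset.sum_mul]
    have h1 := hv.sum_inner_products_le (b i) (s := Finset.univ)
    rw [b.orthonormal.1 i, one_pow] at h1
    refine le_mul_of_le_one_left (log_one_sub_norm_sq_nonpos hR (b.orthonormal.1 i))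
      (le_trans (le_of_eq (Finset.sum_congr rfl fun j _ => ?_)) h1)
    rw [Real.norm_eq_abs, sq_abs, real_inner_comm]
  exact (Real.le_log_iff_exp_le ((Real.exp_pos _).trans_le h)).2 h

end LogDet

/-! ### The entropic profit in an eigenbasis -/

section Profit

variable {ι : Type*} {G M : H →L[ℝ] H} {ε : ℝ} {b : HilbertBasis ι ℝ H} {μ : ι → ℝ}

theorem summable_mul_inner_apply (hμ : ∀ i, 0 ≤ μ i) (hs : Summable μ) (R : H →L[ℝ] H) :
    Summable fun i => μ i * ⟪b i, R (b i)⟫_ℝ := by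
  refine Summable.of_norm_bounded (hs.mul_right ‖R‖) fun i => ?_
  rw [norm_mul, Real.norm_eq_abs, abs_of_nonneg (hμ i)]
  refine mul_le_mul_of_nonneg_left ?_ (hμ i)
  refine (norm_inner_le_norm _ _).trans ?_
  rw [b.orthonormal.1 i, one_mul]
  exact (R.le_opNorm _).trans_eq (by rw [b.orthonormal.1 i, mul_one])

theorem profit_le_tsum (hε : 0 < ε) (hb : ∀ i, (adjoint M ∘L G) (b i) = μ i • b i)
    (hμ : ∀ i, 0 ≤ μ i) (hs : Summable μ) {R : H →L[ℝ] H} (hR : ‖R‖ < 1) (h2 : IsSchatten 2 R) :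
    profit ε G M R ≤
      ∑' i, (2 * (μ i * ⟪b i, R (b i)⟫_ℝ) + ε * Real.log (1 - ‖R (b i)‖ ^ 2)) := by
  rw [((summable_mul_inner_apply hμ hs R).mul_left 2).tsum_add
    ((summable_log_one_sub_norm_sq hR h2 b.orthonormal).mul_left ε), tsum_mul_left, tsum_mul_left,
    profit, trace_comp_of_diagonal hb hμ hs]
  exact add_le_add le_rfl
    (mul_le_mul_of_nonneg_left (log_fredholmDet_le_tsum hR h2 b.orthonormal) hε.le)

theorem tsum_le_profit (hε : 0 < ε) (hb : ∀ i, (adjoint M ∘L G) (b i) = μ i • b i)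
    (hμ : ∀ i, 0 ≤ μ i) (hs : Summable μ) {R : H →L[ℝ] H} (hR : ‖R‖ < 1) (h2 : IsSchatten 2 R)
    {ρ : ι → ℝ} (hρ : ∀ i, R (b i) = ρ i • b i) :
    ∑' i, (2 * (μ i * ⟪b i, R (b i)⟫_ℝ) + ε * Real.log (1 - ‖R (b i)‖ ^ 2)) ≤
      profit ε G M R := by
  have hl := summable_log_one_sub_norm_sq hR h2 b.orthonormal
  rw [((summable_mul_inner_apply hμ hs R).mul_left 2).tsum_add (hl.mul_left ε), tsum_mul_left,
    tsum_mul_left, profit, trace_comp_of_diagonal hb hμ hs]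
  exact add_le_add le_rfl
    (mul_le_mul_of_nonneg_left (tsum_log_le_log_fredholmDet hR hρ hl) hε.le)

/-- Strong concavity at the maximiser, tested on eigenvectors. -/
theorem profit_add_sum_le (hε : 0 < ε) (hb : ∀ i, (adjoint M ∘L G) (b i) = μ i • b i)
    (hμ : ∀ i, 0 ≤ μ i) (hs : Summable μ) {R S : H →L[ℝ] H} (hR : ‖R‖ < 1)
    (hR2 : IsSchatten 2 R) (hS : ‖S‖ < 1) (hS2 : IsSchatten 2 S)
    (hSb : ∀ i, S (b i) = shrinkage ε (μ i) • b i) (s : Finset ι) :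
    profit ε G M R + ∑ i ∈ s, ε * ‖R (b i) - S (b i)‖ ^ 2 ≤ profit ε G M S := by
  have hterm : ∀ i, (2 * (μ i * ⟪b i, R (b i)⟫_ℝ) + ε * Real.log (1 - ‖R (b i)‖ ^ 2)) +
      ε * ‖R (b i) - S (b i)‖ ^ 2 ≤
      2 * (μ i * ⟪b i, S (b i)⟫_ℝ) + ε * Real.log (1 - ‖S (b i)‖ ^ 2) := by
    intro i
    have hn := b.orthonormal.1 i
    have e1 : ‖R (b i) - S (b i)‖ ^ 2 = ‖R (b i)‖ ^ 2 -
        2 * shrinkage ε (μ i) * ⟪b i, R (b i)⟫_ℝ + shrinkage ε (μ i) ^ 2 := by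
      rw [hSb, @norm_sub_sq_real, inner_smul_right, norm_smul, hn, mul_one, Real.norm_eq_abs,
        sq_abs, real_inner_comm]
      ring
    have e2 : ⟪b i, S (b i)⟫_ℝ = shrinkage ε (μ i) := by
      rw [hSb, inner_smul_right, real_inner_self_eq_norm_sq, hn, one_pow, mul_one]
    have e3 : ‖S (b i)‖ ^ 2 = shrinkage ε (μ i) ^ 2 := by
      rw [hSb, norm_smul, hn, mul_one, Real.norm_eq_abs, sq_abs]
    rw [e2, e3, e1]
    exact scalar_profit_le hε (hμ i) (sub_pos.1 (one_sub_norm_sq_pos hR hn)) (e1 ▸ sq_nonneg _)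
  have hsumm : ∀ {T : H →L[ℝ] H}, ‖T‖ < 1 → IsSchatten 2 T → Summable fun i =>
      (2 * (μ i * ⟪b i, T (b i)⟫_ℝ) + ε * Real.log (1 - ‖T (b i)‖ ^ 2)) := fun {T} hT hT2 =>
    ((summable_mul_inner_apply hμ hs T).mul_left 2).add
      ((summable_log_one_sub_norm_sq hT hT2 b.orthonormal).mul_left ε)
  have h1 := profit_le_tsum hε hb hμ hs hR hR2
  have h2 := tsum_le_profit hε hb hμ hs hS hS2 hSb
  -- All termwise differences are nonnegative, so those indexed by s are bounded by the full sum.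
  have h3 := sum_le_hasSum s (fun i _ => sub_nonneg.2
    ((le_add_of_nonneg_right (by positivity)).trans (hterm i)))
    ((hsumm hS hS2).hasSum.sub (hsumm hR hR2).hasSum)
  have h4 := Finset.sum_le_sum fun i (_ : i ∈ s) => le_sub_iff_add_le'.2 (hterm i)
  linarith

end Profit

end GaussianEOT

end

/-! ### Admissibility, optimality, uniqueness and trace bound for f_ε(K). -/

open GaussianEOT in
theorem mainTheorem1 {H : Type*} [NormedAddCommGroup H] [InnerProductSpace ℝ H] [CompleteSpace H]
    [TopologicalSpace.SeparableSpace H] (ε : ℝ) (hε : 0 < ε) (A B G M : H →L[ℝ] H)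
    (hA : IsPosTraceClass A) (hB : IsPosTraceClass B) (hG : IsGreen A G) (hM : IsGreen B M)
    (hGM : ProperlyAligned G M) :
    (∀ x : ℝ, 0 ≤ x → 0 ≤ shrinkage ε x ∧ shrinkage ε x < 1) ∧
    spectralCalculus (shrinkage ε) (adjoint G ∘L M) ∈ admissible G M ∧
    (∀ R ∈ admissible G M,
      profit ε G M R ≤ profit ε G M (spectralCalculus (shrinkage ε) (adjoint G ∘L M))) ∧
    (∀ R ∈ admissible G M, (∀ R' ∈ admissible G M, profit ε G M R' ≤ profit ε G M R) →
      R = spectralCalculus (shrinkage ε) (adjoint G ∘L M)) ∧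
    IsPosTraceClass (spectralCalculus (shrinkage ε) (adjoint G ∘L M)) ∧
    schattenNorm 1 (spectralCalculus (shrinkage ε) (adjoint G ∘L M)) ≤
      2 / ε * trace (adjoint G ∘L M) := by
  set K := adjoint G ∘L M with hK
  have hKt : IsPosTraceClass K := hGM
  have hKp := hKt.2
  obtain ⟨hKc, hKs⟩ := (isSchatten_one_iff hKp).1 hKt.1
  have hKa : adjoint M ∘L G = K := by
    rw [← isSelfAdjoint_iff'.1 hKp.isSelfAdjoint, hK, adjoint_comp, adjoint_adjoint]
  obtain ⟨ι, b, μ, hb⟩ := exists_hilbertBasis_eigenvectors hKp.isSelfAdjoint hKc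
  have hμ : ∀ i, 0 ≤ μ i ∧ μ i ≤ ‖K‖ := fun i => eigenvalue_nonneg_and_le hKp fun h => by
    have hm : b i ∈ (K - μ i • ContinuousLinearMap.id ℝ H).ker := by simp [hb]
    rw [h, Submodule.mem_bot] at hm
    exact b.orthonormal.ne_zero i hm
  have hμ0 := fun i => (hμ i).1
  have hs : Summable μ := summable_of_summable_inner hb hμ0 _ hKs
  set S := spectralCalculus (shrinkage ε) K with hS
  -- F is the bounded quotient f_ε(x)/x of K: the factorisation S = F K makes S compact and zero on
  -- ker M and ker G.
  set F := spectralCalculus (fun x => 2 / (√(4 * x ^ 2 + ε ^ 2) + ε)) K with hF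
  have hSb : ∀ i, S (b i) = shrinkage ε (μ i) • b i := fun i =>
    spectralCalculus_apply_of_eigenvector hKp.isSelfAdjoint (C := 1) (fun ν hν => by
      have h0 := (eigenvalue_nonneg_and_le hKp hν).1
      rw [abs_of_nonneg (shrinkage_nonneg hε h0)]
      exact (shrinkage_lt_one hε h0).le) (hb i)
  have hFb : ∀ i, F (b i) = (2 / (√(4 * μ i ^ 2 + ε ^ 2) + ε)) • b i := fun i =>
    spectralCalculus_apply_of_eigenvector hKp.isSelfAdjoint (C := 2 / ε) (fun ν _ => by
      rw [abs_of_nonneg (div_nonneg zero_le_two (shrinkage_denom_pos hε ν).le)]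
      exact div_le_div_of_nonneg_left zero_le_two hε
        (le_add_of_nonneg_left (Real.sqrt_nonneg _))) (hb i)
  have hSF : S = F ∘L K := b.ext_clm fun i => by
    rw [comp_apply, hb, map_smul, hFb, hSb, smul_smul, shrinkage]
    congr 1
    ring
  have hS0 : ∀ i, 0 ≤ shrinkage ε (μ i) := fun i => shrinkage_nonneg hε (hμ0 i)
  have hSc : IsCompactOperator S := by
    rw [hSF]
    exact hKc.clm_comp F
  have hSp : S.IsPositive := isPositive_of_diagonal hSb hS0
  have hSadj : adjoint S = S := isSelfAdjoint_iff'.1 hSp.isSelfAdjoint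
  have hSle : ∀ i, shrinkage ε (μ i) ≤ 2 / ε * μ i := fun i => shrinkage_le_div hε (hμ0 i)
  have hSs : Summable fun i => shrinkage ε (μ i) :=
    Summable.of_nonneg_of_le hS0 hSle (hs.mul_left _)
  have hSn : ‖S‖ < 1 := by
    refine (norm_le_of_diagonal hSb (c := 2 * ‖K‖ / (2 * ‖K‖ + ε)) (by positivity)
      fun i => ?_).trans_lt (two_mul_div_two_mul_add_lt_one hε (norm_nonneg K))
    rw [abs_of_nonneg (hS0 i)]
    exact shrinkage_le_of_le hε (hμ0 i) (hμ i).2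
  have hS2 : IsSchatten 2 S := by
    refine isSchatten_two_iff.2 ⟨hSc, ?_⟩
    have h : Summable fun i => ‖S (b i)‖ ^ 2 := by
      refine Summable.of_nonneg_of_le (fun _ => sq_nonneg _) (fun i => ?_) hSs
      rw [hSb, norm_smul, b.orthonormal.1 i, mul_one, Real.norm_eq_abs, sq_abs, sq]
      exact mul_le_of_le_one_left (hS0 i) (shrinkage_lt_one hε (hμ0 i)).le
    have h' := sum_norm_sq_adjoint_le b h (onb H).orthonormal
    rw [hSadj] at h'
    exact summable_of_sum_le (fun _ => sq_nonneg _) h'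
  have hSadm : S ∈ admissible G M := by
    refine ⟨hS2, fun x hx => ?_, ?_, hSn⟩
    · have hx' : M x = 0 := hx
      change S x = 0
      rw [hSF, comp_apply, hK, comp_apply, hx', map_zero, map_zero]
    -- Since S is self-adjoint and kills ker G, its range is orthogonal to ker G.
    · rintro _ ⟨x, rfl⟩
      rw [Submodule.mem_orthogonal]
      intro w hw
      have hw' : G w = 0 := hw
      have h0 : S w = 0 := by rw [hSF, comp_apply, ← hKa, comp_apply, hw', map_zero, map_zero]
      have h1 : ⟪S w, x⟫_ℝ = ⟪w, S x⟫_ℝ := hSp.isSymmetric w x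
      rw [h0, inner_zero_left] at h1
      exact h1.symm
  have hbM : ∀ i, (adjoint M ∘L G) (b i) = μ i • b i := hKa ▸ hb
  have hgap : ∀ R ∈ admissible G M, ∀ s : Finset ι,
      profit ε G M R + ∑ i ∈ s, ε * ‖R (b i) - S (b i)‖ ^ 2 ≤ profit ε G M S := fun R hR s =>
    profit_add_sum_le hε hbM hμ0 hs hR.2.2.2 hR.1 hSn hS2 hSb s
  refine ⟨fun x hx => ⟨shrinkage_nonneg hε hx, shrinkage_lt_one hε hx⟩, hSadm, fun R hR => ?_,
    fun R hR hmax => b.ext_clm fun j => ?_, ⟨(isSchatten_one_iff hSp).2 ⟨hSc, ?_⟩, hSp⟩, ?_⟩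
  · simpa using hgap R hR ∅
  -- The gap at the single index j must vanish, so R and S agree on b j.
  · have h1 := hgap R hR {j}
    rw [Finset.sum_singleton] at h1
    have h2 := hmax S hSadm
    have h3 : ‖R (b j) - S (b j)‖ ^ 2 ≤ 0 := by
      by_contra h
      have := mul_pos hε (not_le.1 h)
      linarith
    exact sub_eq_zero.1 (norm_eq_zero.1 (pow_eq_zero_iff two_ne_zero |>.1
      (le_antisymm h3 (sq_nonneg _))))
  · exact (hasSum_inner_comp_of_diagonal hSb hS0 hSs (onb H)
      (ContinuousLinearMap.id ℝ H)).summable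
  · rw [schattenNorm_one hSc hSp, trace_of_diagonal hSb hS0 hSs, trace_of_diagonal hb hμ0 hs,
      ← tsum_mul_left]
    exact hSs.tsum_le_tsum hSle (hs.mul_left _)
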